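/- Let $S$ be a finite $2$-group. A fusion system $\mathcal F$ over $S$ is a category whose objects are the subgroups of $S$, whose morphism sets $\operatorname{Hom}_{\mathcal F}(P,Q)$ consist of injective group homomorphisms $P\to Q$ and contain all homomorphisms $P\to Q$ induced by conjugation with elements of $S$, whose composition is the composition of maps, and in which each morphism is the composite of an isomorphism of $\mathcal F$ followed by an inclusion. For $P\le S$ let $\operatorname{Aut}_S(P)$ be the group of automorphisms of $P$ induced by conjugation with elements of $N_S(P)$, and let $\operatorname{Aut}_{\mathcal F}(P)$ be the automorphism group of $P$ in $\mathcal F$. The fusion system $\mathcal F$ is saturated if every subgroup of $S$ is isomorphic in $\mathcal F$ to a subgroup $P$ such that (i) $\operatorname{Aut}_S(P)$ is a Sylow $2$-subgroup of $\operatorname{Aut}_{\mathcal F}(P)$, and (ii) for every $Q\le S$, every isomorphism $\varphi:Q\to P$ in $\mathcal F$ extends to a morphism $N_\varphi\to S$ in $\mathcal F$, where $N_\varphi=\{g\in N_S(Q) : \varphi c_g\varphi^{-1}\in\operatorname{Aut}_S(P)\}$ and $c_g$ denotes conjugation by $g$ on $Q$. **Theorem.** Let $\mathcal F$ be a saturated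 fusion system over a finite $2$-group $S$ such that $\operatorname{Hom}_{\mathcal F}(\langle x\rangle,Z(S))\neq\emptyset$ for every $x\in S$. Then $S$ is abelian. -/

import Mathlib

/-- For subgroups `P`, `Q` of `S` and `s : S` with `s P s⁻¹ ≤ Q`, the homomorphism
`c_s : P → Q`, `x ↦ s x s⁻¹`. -/
def conjHom {S : Type*} [Group S] (P Q : Subgroup S) (s : S)
    (h : ∀ x ∈ P, s * x * s⁻¹ ∈ Q) : P →* Q where
  toFun x := ⟨s * x * s⁻¹, h x x.2⟩
  map_one' := by ext; simp
  map_mul' x y := by ext; simp [mul_assoc]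

/-- A fusion system over `S`: a category whose objects are all subgroups of `S` and whose morphisms
from `P` to `Q` are certain injective group homomorphisms, including all those induced by
conjugation in `S` (in particular identities and inclusions), with the usual composition, such that
each morphism is an isomorphism of the category followed by an inclusion. -/
structure FusionSystem (S : Type*) [Group S] where
  /-- The set of morphisms from `P` to `Q`. -/
  Hom (P Q : Subgroup S) : Set (P →* Q)
  injective {P Q : Subgroup S} (φ : P →* Q) : φ ∈ Hom P Q → Function.Injective φ
  conj_mem (P Q : Subgroup S) (s : S) (h : ∀ x ∈ P, s * x * s⁻¹ ∈ Q) :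
    conjHom P Q s h ∈ Hom P Q
  comp_mem {P Q R : Subgroup S} (ψ : Q →* R) (φ : P →* Q) :
    ψ ∈ Hom Q R → φ ∈ Hom P Q → ψ.comp φ ∈ Hom P R
  factor {P Q : Subgroup S} (φ : P →* Q) : φ ∈ Hom P Q →
    ∃ (R : Subgroup S) (hR : R ≤ Q) (ψ : P ≃* R),
      ψ.toMonoidHom ∈ Hom P R ∧ ψ.symm.toMonoidHom ∈ Hom R P ∧
        φ = (Subgroup.inclusion hR).comp ψ.toMonoidHom

namespace FusionSystem

variable {S : Type*} [Group S]

/-- `φ` is an isomorphism of the category `F`: it and its inverse are morphisms of `F`. -/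
def IsIso (F : FusionSystem S) {P Q : Subgroup S} (φ : P ≃* Q) : Prop :=
  φ.toMonoidHom ∈ F.Hom P Q ∧ φ.symm.toMonoidHom ∈ F.Hom Q P

/-- `P` and `Q` are `F`-conjugate: they are isomorphic in the category `F`. -/
def IsConjugate (F : FusionSystem S) (P Q : Subgroup S) : Prop :=
  ∃ φ : P ≃* Q, F.IsIso φ

/-- The automorphism group `Aut_F(P)` of `P` in the category `F`. -/
def aut (F : FusionSystem S) (P : Subgroup S) : Subgroup (MulAut P) where
  carrier := {α | F.IsIso α}
  one_mem' := by
    have h : (MonoidHom.id P) ∈ F.Hom P P := by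
      have := F.conj_mem P P 1 (by simp)
      convert this
      ext; simp [conjHom]
    exact ⟨h, h⟩
  mul_mem' {α β} hα hβ := ⟨F.comp_mem _ _ hα.1 hβ.1, F.comp_mem _ _ hβ.2 hα.2⟩
  inv_mem' {α} hα := ⟨hα.2, hα.1⟩

/-- `Aut_S(P)`: the automorphisms of `P` induced by conjugation with elements of `N_S(P)`. -/
def autS (P : Subgroup S) : Subgroup (MulAut P) :=
  P.normalizerMonoidHom.range

theorem autS_le_aut (F : FusionSystem S) (P : Subgroup S) : autS P ≤ F.aut P := by
  rintro _ ⟨g, rfl⟩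
  have key : ∀ g : Subgroup.normalizer (P : Set S),
      (P.normalizerMonoidHom g : P ≃* P).toMonoidHom ∈ F.Hom P P := by
    intro g
    exact F.conj_mem P P g (fun x hx => (P.normalizerMonoidHom g ⟨x, hx⟩).2)
  refine ⟨key g, ?_⟩
  have := key g⁻¹
  rw [map_inv] at this
  exact this

/-- `P` is fully automized in `F`: `Aut_S(P)` is a Sylow `p`-subgroup of `Aut_F(P)`. -/
def FullyAutomized (p : ℕ) (F : FusionSystem S) (P : Subgroup S) : Prop :=
  ∃ T : Sylow p (F.aut P), (T : Subgroup (F.aut P)) = (autS P).subgroupOf (F.aut P)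

/-- `N_φ = {g ∈ N_S(Q) | φ c_g φ⁻¹ ∈ Aut_S(P)}` for an isomorphism `φ : Q → P`. -/
def extender {Q P : Subgroup S} (φ : Q ≃* P) : Subgroup S :=
  ((autS P).comap ((MulAut.congr φ).toMonoidHom.comp Q.normalizerMonoidHom)).map
    (Subgroup.normalizer (Q : Set S)).subtype

theorem le_extender {Q P : Subgroup S} (φ : Q ≃* P) : Q ≤ extender φ := by
  intro x hx
  refine ⟨⟨x, Subgroup.le_normalizer hx⟩, ?_, rfl⟩
  refine ⟨⟨φ ⟨x, hx⟩, Subgroup.le_normalizer (φ ⟨x, hx⟩).2⟩, ?_⟩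
  ext y
  obtain ⟨z, rfl⟩ := φ.surjective y
  have h1 : φ (⟨x, hx⟩ * z * ⟨x, hx⟩⁻¹) = φ ⟨x, hx⟩ * φ z * (φ ⟨x, hx⟩)⁻¹ := by
    simp only [map_mul, map_inv]
  have h2 : (MulAut.congr φ (Q.normalizerMonoidHom ⟨x, Subgroup.le_normalizer hx⟩)) (φ z) =
      φ (⟨x, hx⟩ * z * ⟨x, hx⟩⁻¹) := by
    change φ (Q.normalizerMonoidHom ⟨x, Subgroup.le_normalizer hx⟩ (φ.symm (φ z))) = _
    rw [φ.symm_apply_apply]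
    rfl
  exact congrArg Subtype.val (h1.symm.trans h2.symm)

/-- `P` is receptive in `F`: each `F`-isomorphism `φ : Q → P` extends to a morphism
`N_φ → S` of `F`. -/
def Receptive (F : FusionSystem S) (P : Subgroup S) : Prop :=
  ∀ (Q : Subgroup S) (φ : Q ≃* P), F.IsIso φ →
    ∃ ψ ∈ F.Hom (extender φ) ⊤,
      ∀ x : Q, (ψ (Subgroup.inclusion (le_extender φ) x) : S) = φ x

/-- `F` is saturated (with respect to the prime `p`): every subgroup of `S` is `F`-conjugate to
one which is fully automized and receptive. -/
def IsSaturated (p : ℕ) (F : FusionSystem S) : Prop :=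
  ∀ P : Subgroup S, ∃ Q : Subgroup S,
    F.IsConjugate P Q ∧ F.FullyAutomized p Q ∧ F.Receptive Q

end FusionSystem

namespace FusionSystem

variable {S : Type*} [Group S] {F : FusionSystem S}

/-! By induction on `k`, the solutions of `x ^ 2 ^ k = 1` are central. Let `N` be the central
subgroup they form, and let `x`, `y` have squares in `N`. Modulo `N`, `x` inverts `w = x * y`, so
`x` normalizes `H = ⟨w⟩N` and acts on it with square 1. A strongly closed abelian subgroup is normal
in the fusion system (`exists_isIso_sup`), so a morphism from `⟨w⟩` into the center extends to `H`,
again with central image, and that image may be taken fully automized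
(`exists_central_of_le_center`). Such a central subgroup has an automorphism group of odd order
(`aut_eq_one_of_sq_eq_one`), so `x` centralizes `w` and hence `y` (`commute_of_sq_mem`). Thus the
solutions of `x ^ 2 ^ (k + 1) = 1` form an abelian strongly closed subgroup, which is central by the
extension property again (`StronglyClosed.le_center`). -/

theorem IsIso.symm {P Q : Subgroup S} {e : P ≃* Q} (he : F.IsIso e) : F.IsIso e.symm :=
  ⟨he.2, he.1⟩

theorem IsIso.trans {P Q R : Subgroup S} {e : P ≃* Q} {f : Q ≃* R} (he : F.IsIso e)
    (hf : F.IsIso f) : F.IsIso (e.trans f) :=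
  ⟨F.comp_mem _ _ hf.1 he.1, F.comp_mem _ _ he.2 hf.2⟩

theorem inclusion_mem_Hom (F : FusionSystem S) {P Q : Subgroup S} (h : P ≤ Q) :
    Subgroup.inclusion h ∈ F.Hom P Q := by
  have := F.conj_mem P Q 1 (fun x hx => by simpa using h hx)
  convert this
  ext x
  simp [conjHom]

/-- Every morphism restricts to an isomorphism from a given subgroup of its domain onto the
image. -/
theorem exists_isIso_restrict {P Q T : Subgroup S} (hT : T ≤ P) {φ : P →* Q}
    (hφ : φ ∈ F.Hom P Q) :
    ∃ (R : Subgroup S) (e : T ≃* R), R ≤ Q ∧ F.IsIso e ∧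
      ∀ x : T, (e x : S) = φ (Subgroup.inclusion hT x) := by
  obtain ⟨R, hR, e, h₁, h₂, h₃⟩ := F.factor _ (F.comp_mem _ _ hφ (F.inclusion_mem_Hom hT))
  refine ⟨R, e, hR, ⟨h₁, h₂⟩, fun x => ?_⟩
  have := congrArg Subtype.val (DFunLike.congr_fun h₃ x)
  simpa using this.symm

/-! ### Strongly closed subgroups and series stabilizers -/

/-- `E` is strongly closed in `F`: no morphism of `F` maps an element of `E` outside `E`. -/
def StronglyClosed (F : FusionSystem S) (E : Subgroup S) : Prop :=
  ∀ (P Q : Subgroup S) (φ : P →* Q), φ ∈ F.Hom P Q → ∀ x : P, (x : S) ∈ E → (φ x : S) ∈ E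

theorem StronglyClosed.normal {E : Subgroup S} (hE : F.StronglyClosed E) : E.Normal :=
  ⟨fun x hx s => hE ⊤ ⊤ _ (F.conj_mem ⊤ ⊤ s (by simp)) ⟨x, trivial⟩ hx⟩

theorem StronglyClosed.mem_iff {E : Subgroup S} (hE : F.StronglyClosed E) {P Q : Subgroup S}
    {e : P ≃* Q} (he : F.IsIso e) (x : P) : (e x : S) ∈ E ↔ (x : S) ∈ E :=
  ⟨fun h => by simpa using hE _ _ _ he.2 (e x) h, hE _ _ _ he.1 x⟩

/-- The `F`-automorphisms of `Q` that stabilize the series `1 ≤ E ∩ Q ≤ Q`. -/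
def stabilizer (F : FusionSystem S) (E Q : Subgroup S) [E.Normal] : Subgroup (F.aut Q) where
  carrier := {α | (∀ y : Q, ((α : MulAut Q) y : S) * (y : S)⁻¹ ∈ E) ∧
    ∀ y : Q, (y : S) ∈ E → (α : MulAut Q) y = y}
  one_mem' := by simp
  mul_mem' {α β} hα hβ := by
    refine ⟨fun y => ?_, fun y hy => ?_⟩
    · have := E.mul_mem (hα.1 ((β : MulAut Q) y)) (hβ.1 y)
      simpa using this
    · simp [hβ.2 y hy, hα.2 y hy]
  inv_mem' {α} hα := by
    refine ⟨fun y => ?_, fun y hy => ?_⟩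
    · have := E.inv_mem (hα.1 ((α : MulAut Q)⁻¹ y))
      simpa using this
    · have := hα.2 y hy
      simp only [InvMemClass.coe_inv]
      conv_lhs => rw [← this]
      simp

theorem stabilizer_normal {E : Subgroup S} [E.Normal] (hE : F.StronglyClosed E)
    (Q : Subgroup S) : (F.stabilizer E Q).Normal := by
  refine ⟨fun α hα β => ⟨fun y => ?_, fun y hy => ?_⟩⟩
  · have h := hα.1 ((β : MulAut Q)⁻¹ y)
    have := hE _ _ _ β.2.1
      ((α : MulAut Q) ((β : MulAut Q)⁻¹ y) * ((β : MulAut Q)⁻¹ y)⁻¹) (by simpa using h)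
    simpa using this
  · have h : (((β : MulAut Q)⁻¹ y : Q) : S) ∈ E := hE _ _ _ β.2.2 y hy
    have := hα.2 _ h
    change (β : MulAut Q) ((α : MulAut Q) ((β : MulAut Q)⁻¹ y)) = y
    rw [this, MulAut.apply_inv_self]

theorem stabilizer_isPGroup {p : ℕ} (hS : IsPGroup p S) [Finite S] [Fact p.Prime]
    (E Q : Subgroup S) [E.Normal] : IsPGroup p (F.stabilizer E Q) := by
  obtain ⟨n, hn⟩ := IsPGroup.iff_card.1 hS
  rintro ⟨α, hα⟩
  refine ⟨n, ?_⟩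
  -- `α` fixes `α y * y⁻¹`, an element of `E ∩ Q`, so each application of `α` contributes one more
  -- factor; the power `m = |S|` kills them all.
  have key : ∀ (y : Q) (m : ℕ),
      ((α : MulAut Q) ^ m) y = ((α : MulAut Q) y * y⁻¹) ^ m * y := by
    intro y m
    induction m with
    | zero => simp
    | succ m ih =>
      have h : (α : MulAut Q) ((α : MulAut Q) y * y⁻¹) = (α : MulAut Q) y * y⁻¹ :=
        hα.2 _ (by simpa using hα.1 y)
      rw [pow_succ', MulAut.mul_apply, ih, map_mul, map_pow, h, pow_succ]
      group
  ext y
  have h1 : ((α : MulAut Q) y * y⁻¹) ^ p ^ n = 1 := by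
    ext
    rw [← hn]
    simp only [SubgroupClass.coe_pow, Subgroup.coe_one]
    exact pow_card_eq_one'
  have := key y (p ^ n)
  rw [h1, one_mul] at this
  simp [this]

/-- The stabilizer is a normal `p`-subgroup, so it lies in every Sylow `p`-subgroup. -/
theorem mem_autS_of_mem_stabilizer {p : ℕ} (hS : IsPGroup p S) [Finite S] [Fact p.Prime]
    {E Q : Subgroup S} [E.Normal] (hE : F.StronglyClosed E) (hQ : F.FullyAutomized p Q)
    {α : F.aut Q} (hα : α ∈ F.stabilizer E Q) : (α : MulAut Q) ∈ autS Q := by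
  obtain ⟨T, hT⟩ := hQ
  have := F.stabilizer_normal hE Q
  have h : IsPGroup p ((F.stabilizer E Q ⊔ T : Subgroup (F.aut Q))) :=
    IsPGroup.to_sup_of_normal_left (stabilizer_isPGroup hS E Q) T.2
  have h' := T.is_maximal' h le_sup_right
  have h2 : α ∈ (T : Subgroup (F.aut Q)) := by
    rw [← h']; exact Subgroup.mem_sup_left hα
  rw [hT] at h2
  exact h2

theorem conj_mem_aut {P Q : Subgroup S} {e : P ≃* Q} (he : F.IsIso e)
    (g : Subgroup.normalizer (P : Set S)) :
    MulAut.congr e (P.normalizerMonoidHom g) ∈ F.aut Q :=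
  (he.symm.trans (F.autS_le_aut P ⟨g, rfl⟩)).trans he

theorem mem_extender {P Q : Subgroup S} {e : P ≃* Q} {g : S}
    (hg : g ∈ Subgroup.normalizer (P : Set S))
    (h : MulAut.congr e (P.normalizerMonoidHom ⟨g, hg⟩) ∈ autS Q) : g ∈ extender e :=
  ⟨⟨g, hg⟩, h, rfl⟩

theorem congr_normalizerMonoidHom_apply {P Q : Subgroup S} (e : P ≃* Q)
    (g : Subgroup.normalizer (P : Set S)) (x : P) :
    MulAut.congr e (P.normalizerMonoidHom g) (e x) = e (P.normalizerMonoidHom g x) := by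
  change e (P.normalizerMonoidHom g (e.symm (e x))) = _
  rw [e.symm_apply_apply]

/-- As `E` is normal and abelian, `g` acts trivially on `E ∩ P` and on `P` modulo `E`; strong
closure carries this over to `Q`, where the series stabilizer lies in `autS Q`. -/
theorem mem_extender_of_mem_normalizer {p : ℕ} (hS : IsPGroup p S) [Finite S] [Fact p.Prime]
    {E : Subgroup S} (hE : F.StronglyClosed E) (hcomm : ∀ a ∈ E, ∀ b ∈ E, a * b = b * a)
    {P Q : Subgroup S} (hQ : F.FullyAutomized p Q) {e : P ≃* Q} (he : F.IsIso e) {g : S}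
    (hgE : g ∈ E) (hg : g ∈ Subgroup.normalizer (P : Set S)) : g ∈ extender e := by
  have := hE.normal
  refine mem_extender hg (mem_autS_of_mem_stabilizer hS hE hQ
    (α := ⟨_, conj_mem_aut he ⟨g, hg⟩⟩) ⟨fun y => ?_, fun y hy => ?_⟩)
  · obtain ⟨x, rfl⟩ := e.surjective y
    rw [congr_normalizerMonoidHom_apply]
    have h : ((P.normalizerMonoidHom ⟨g, hg⟩ x * x⁻¹ : P) : S) ∈ E := by
      change g * x * g⁻¹ * (x : S)⁻¹ ∈ E
      have := E.mul_mem hgE (this.conj_mem _ (E.inv_mem hgE) x)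
      simpa [mul_assoc] using this
    simpa using (hE.mem_iff he _).2 h
  · obtain ⟨x, rfl⟩ := e.surjective y
    rw [congr_normalizerMonoidHom_apply]
    congr 1
    ext
    change g * x * g⁻¹ = x
    rw [hcomm g hgE x ((hE.mem_iff he x).1 hy), mul_inv_cancel_right]

/-- Normalizers grow in the nilpotent group `PE`; the factor in `P` of the element found can be
stripped off. -/
theorem exists_mem_normalizer_of_not_le {p : ℕ} (hS : IsPGroup p S) [Finite S] [Fact p.Prime]
    {E P : Subgroup S} [E.Normal] (h : ¬ E ≤ P) :
    ∃ g ∈ E, g ∉ P ∧ g ∈ Subgroup.normalizer (P : Set S) := by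
  have hnil : Group.IsNilpotent ((P ⊔ E : Subgroup S)) :=
    (hS.to_subgroup (P ⊔ E)).isNilpotent
  have hlt : P.subgroupOf (P ⊔ E) < ⊤ := by
    rw [lt_top_iff_ne_top, Ne, Subgroup.subgroupOf_eq_top]
    exact fun hle => h (le_sup_right.trans hle)
  obtain ⟨⟨x, hx⟩, hx1, hx2⟩ := SetLike.exists_of_lt (Group.normalizerCondition_of_isNilpotent _ hlt)
  obtain ⟨a, ha, b, hb, rfl⟩ := Subgroup.mem_sup_of_normal_right.1 hx
  have hab : a * b ∈ Subgroup.normalizer (P : Set S) := by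
    rw [Subgroup.mem_normalizer_iff] at hx1 ⊢
    intro y
    constructor
    · intro hy
      have := (hx1 ⟨y, Subgroup.mem_sup_left hy⟩).1 hy
      exact this
    · intro hy
      have hy' : y ∈ P ⊔ E := by
        have := mul_mem (mul_mem (inv_mem hx) (Subgroup.mem_sup_left (T := E) hy)) hx
        simpa [mul_assoc] using this
      exact (hx1 ⟨y, hy'⟩).2 hy
  refine ⟨b, hb, fun hbP => hx2 (P.mul_mem ha hbP), ?_⟩
  have := mul_mem (inv_mem (Subgroup.le_normalizer ha)) hab
  simpa using this

/-! ### Extension of isomorphisms -/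

/-- In a saturated fusion system, every central subgroup is conjugate to a fully automized central
subgroup. -/
theorem exists_central_of_le_center [Finite S] {p : ℕ} (hF : F.IsSaturated p)
    {R : Subgroup S} (hR : R ≤ Subgroup.center S) :
    ∃ (D : Subgroup S) (e : R ≃* D), F.IsIso e ∧ F.FullyAutomized p D ∧
      D ≤ Subgroup.center S := by
  obtain ⟨D, ⟨e, he⟩, hD, hrec⟩ := hF R
  refine ⟨D, e, he, hD, ?_⟩
  obtain ⟨ψ, hψ, hψe⟩ := hrec R e he
  have hconj (s : S) (r : R) : s * r * s⁻¹ = r := by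
    rw [Subgroup.mem_center_iff.1 (hR r.2) s, mul_inv_cancel_right]
  have htop (s : S) : s ∈ extender e := by
    have hs : s ∈ Subgroup.normalizer (R : Set S) := by
      rw [Subgroup.mem_normalizer_iff]
      refine fun y => ⟨fun hy => by rwa [hconj s ⟨y, hy⟩], fun hy => ?_⟩
      have := hconj s⁻¹ ⟨_, hy⟩
      simp only [mul_assoc, inv_mul_cancel_left, inv_inv, inv_mul_cancel, mul_one] at this
      rw [this]
      simpa [mul_assoc] using hy
    refine mem_extender hs ?_
    convert (autS D).one_mem
    ext y
    obtain ⟨x, rfl⟩ := e.surjective y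
    rw [congr_normalizerMonoidHom_apply]
    have : R.normalizerMonoidHom ⟨s, hs⟩ x = x := Subtype.ext (hconj s x)
    simp [this]
  have hinj : Function.Injective fun s : S => (ψ ⟨s, htop s⟩ : S) := fun s t hst =>
    congrArg Subtype.val (F.injective ψ hψ (Subtype.ext hst))
  -- The extension is thus an automorphism of `S`, so it preserves the center.
  have hsurj := Finite.surjective_of_injective hinj
  intro d hd
  obtain ⟨r, hr⟩ := e.surjective ⟨d, hd⟩
  have hd' : (ψ ⟨r, htop r⟩ : S) = d := (hψe r).trans (congrArg Subtype.val hr)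
  rw [Subgroup.mem_center_iff]
  intro g
  obtain ⟨t, rfl⟩ := hsurj g
  rw [← hd']
  have hc := Subgroup.mem_center_iff.1 (hR r.2) t
  have h2 : ψ (⟨t, htop t⟩ * ⟨r, htop r⟩) = ψ (⟨r, htop r⟩ * ⟨t, htop t⟩) :=
    congrArg ψ (Subtype.ext hc)
  rw [map_mul, map_mul] at h2
  exact congrArg Subtype.val h2

/-- A strongly closed abelian subgroup `E` is normal in a saturated fusion system: every
isomorphism extends to the product of its domain with `E`. -/
theorem exists_isIso_sup {p : ℕ} (hS : IsPGroup p S) [Finite S] [Fact p.Prime]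
    (hF : F.IsSaturated p) {E : Subgroup S} (hE : F.StronglyClosed E)
    (hcomm : ∀ a ∈ E, ∀ b ∈ E, a * b = b * a) (P : Subgroup S) :
    ∀ (Q : Subgroup S) (e : P ≃* Q), F.IsIso e →
      ∃ (R : Subgroup S) (f : (P ⊔ E : Subgroup S) ≃* R), F.IsIso f ∧
        ∀ x : P, (f (Subgroup.inclusion le_sup_left x) : S) = e x := by
  have := hE.normal
  induction hn : Nat.card S - Nat.card P using Nat.strong_induction_on generalizing P with
  | _ n ih =>
    -- Stated for every domain of the order of `P`, since it is applied to both `P` and `Q`.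
    have good : ∀ (P' Q : Subgroup S) (e : P' ≃* Q), F.IsIso e → Nat.card P' = Nat.card P →
        F.FullyAutomized p Q → F.Receptive Q →
        ∃ (R : Subgroup S) (f : (P' ⊔ E : Subgroup S) ≃* R), F.IsIso f ∧
          ∀ x : P', (f (Subgroup.inclusion le_sup_left x) : S) = e x := by
      intro P Q e he hP hQ hrec
      by_cases hEP : E ≤ P
      · obtain ⟨R, f, -, hf, hfe⟩ := exists_isIso_restrict (sup_le le_rfl hEP) he.1
        exact ⟨R, f, hf, fun x => by rw [hfe]; rfl⟩
      obtain ⟨g, hgE, hgP, hg⟩ := exists_mem_normalizer_of_not_le hS hEP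
      have hgx := mem_extender_of_mem_normalizer hS hE hcomm hQ he hgE hg
      obtain ⟨ψ, hψ, hψe⟩ := hrec P e he
      obtain ⟨R, f, -, hf, hfψ⟩ := exists_isIso_restrict le_rfl hψ
      have hlt : Nat.card P < Nat.card (extender e) := by
        by_contra! hle
        exact hgP (Subgroup.eq_of_le_of_card_ge (le_extender e) hle ▸ hgx)
      have hle := Subgroup.card_le_card_group (extender e)
      obtain ⟨R', f', hf', hfe'⟩ := ih _ (by omega) (extender e) rfl R f hf
      have hsup : P ⊔ E ≤ extender e ⊔ E := sup_le_sup_right (le_extender e) E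
      obtain ⟨T, t, -, ht, hte⟩ := exists_isIso_restrict hsup hf'.1
      refine ⟨T, t, ht, fun x => ?_⟩
      rw [hte, ← hψe]
      exact (hfe' (Subgroup.inclusion (le_extender e) x)).trans (hfψ _)
    intro Q e he
    obtain ⟨G, ⟨u, hu⟩, hG, hG'⟩ := hF Q
    obtain ⟨R₁, f, hf, hfu⟩ := good Q G u hu (Nat.card_congr e.toEquiv).symm hG hG'
    obtain ⟨R₂, g, hg, hgu⟩ := good P G (e.trans u) (he.trans hu) rfl hG hG'
    -- By strong closure and finiteness, `f` permutes `E`.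
    have hER : E ≤ R₁ := by
      have hinj : Function.Injective fun x : E =>
          (⟨f ⟨x, Subgroup.mem_sup_right x.2⟩,
            (hE.mem_iff hf ⟨x, Subgroup.mem_sup_right x.2⟩).2 x.2⟩ : E) := by
        intro x y hxy
        have h1 := Subtype.ext_iff.1 hxy
        have := f.injective (Subtype.ext h1)
        exact Subtype.ext (by simpa using this)
      intro b hb
      obtain ⟨x, hx⟩ := Finite.surjective_of_injective hinj ⟨b, hb⟩
      obtain rfl := Subtype.ext_iff.1 hx
      exact (f _).2
    have hGR : G ≤ R₁ := by
      intro y hy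
      obtain ⟨x, hx⟩ := u.surjective ⟨y, hy⟩
      have h1 := (hfu x).trans (congrArg Subtype.val hx)
      obtain rfl : _ = y := h1
      exact (f _).2
    have hR : R₂ ≤ R₁ := by
      intro y hy
      obtain ⟨⟨x, hx⟩, hxy⟩ := g.surjective ⟨y, hy⟩
      obtain ⟨a, ha, b, hb, rfl⟩ := Subgroup.mem_sup_of_normal_right.1 hx
      have h1 : g ⟨a * b, hx⟩ =
          g ⟨a, Subgroup.mem_sup_left ha⟩ * g ⟨b, Subgroup.mem_sup_right hb⟩ := by
        rw [← map_mul]; rfl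
      obtain rfl := Subtype.ext_iff.1 (h1.symm.trans hxy)
      refine R₁.mul_mem (hGR ?_) (hER ((hE.mem_iff hg _).2 hb))
      refine (hgu ⟨a, ha⟩).symm ▸ ?_
      exact ((e.trans u) ⟨a, ha⟩).2
    -- The desired extension of `e` is `f⁻¹ ∘ g`.
    obtain ⟨T, t, -, ht, htf⟩ := exists_isIso_restrict hR hf.symm.1
    refine ⟨T, g.trans t, hg.trans ht, fun x => ?_⟩
    rw [MulEquiv.trans_apply, htf]
    have : Subgroup.inclusion hR (g (Subgroup.inclusion le_sup_left x)) =
        f (Subgroup.inclusion le_sup_left (e x)) := by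
      ext
      rw [hfu]
      simpa using hgu x
    rw [this]
    simp

/-! ### Centrality by induction on the exponent -/

/-- Centrality makes `autS D` trivial; being Sylow, it forces `F.aut D` to have odd order. -/
theorem aut_eq_one_of_sq_eq_one [Finite S] {D : Subgroup S} (hD : F.FullyAutomized 2 D)
    (hDc : D ≤ Subgroup.center S) {α : MulAut D} (hα : α ∈ F.aut D) (h2 : α ^ 2 = 1) :
    α = 1 := by
  have hbot : autS D = ⊥ := by
    rw [eq_bot_iff]
    rintro _ ⟨g, rfl⟩
    rw [Subgroup.mem_bot]
    ext y
    change (g : S) * y * (g : S)⁻¹ = y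
    rw [Subgroup.mem_center_iff.1 (hDc y.2) g, mul_inv_cancel_right]
  obtain ⟨T, hT⟩ := hD
  have hT1 : Nat.card T = 1 := by
    have : (T : Subgroup (F.aut D)) = ⊥ := by
      rw [hT, hbot]
      exact (MonoidHom.ker_eq_bot_iff _).2 (Subgroup.subtype_injective _)
    exact Subgroup.card_eq_one.2 this
  have hp : IsPGroup 2 (Subgroup.zpowers (⟨α, hα⟩ : F.aut D)) := by
    have : (⟨α, hα⟩ : F.aut D) ^ 2 = 1 := Subtype.ext h2
    obtain ⟨k, -, hk⟩ := (Nat.dvd_prime_pow Nat.prime_two (m := 1)).1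
      (by simpa only [pow_one] using orderOf_dvd_of_pow_eq_one this)
    exact IsPGroup.of_card (n := k) (by rw [Nat.card_zpowers, hk])
  obtain ⟨U, hU⟩ := hp.exists_le_sylow
  have hU1 : (U : Subgroup (F.aut D)) = ⊥ := by
    rw [← Subgroup.card_eq_one, ← hT1]
    exact Nat.card_congr (U.equiv T).toEquiv
  rw [hU1, le_bot_iff, Subgroup.zpowers_eq_bot] at hU
  exact congrArg Subtype.val hU

theorem exists_isIso_zpowers_central {x : S}
    (h : (F.Hom (Subgroup.zpowers x) (Subgroup.center S)).Nonempty) :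
    ∃ (C : Subgroup S) (e : Subgroup.zpowers x ≃* C), F.IsIso e ∧ C ≤ Subgroup.center S := by
  obtain ⟨φ, hφ⟩ := h
  obtain ⟨C, e, hC, he, -⟩ := exists_isIso_restrict le_rfl hφ
  exact ⟨C, e, he, hC⟩

/-- A subgroup consisting of all solutions of `x ^ n = 1` is strongly closed. -/
theorem stronglyClosed_of_forall_mem_iff_pow {E : Subgroup S} {n : ℕ}
    (hE : ∀ x, x ∈ E ↔ x ^ n = 1) : F.StronglyClosed E := by
  intro P Q φ _ x hx
  rw [hE] at hx ⊢
  have : x ^ n = 1 := Subtype.ext hx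
  have := congrArg Subtype.val (congrArg φ this)
  simpa using this

/-- If the elements with `x ^ n = 1` form a central subgroup `N`, then elements whose squares
lie in `N` commute. -/
theorem commute_of_sq_mem [Finite S] (hS : IsPGroup 2 S) (hF : F.IsSaturated 2)
    (h : ∀ x : S, (F.Hom (Subgroup.zpowers x) (Subgroup.center S)).Nonempty)
    {N : Subgroup S} (hN : F.StronglyClosed N) (hNc : N ≤ Subgroup.center S) {x y : S}
    (hx : x ^ 2 ∈ N) (hy : y ^ 2 ∈ N) : x * y = y * x := by
  have : Fact (Nat.Prime 2) := ⟨Nat.prime_two⟩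
  have hcen {a : S} (ha : a ∈ N) (b : S) : b * a = a * b := Subgroup.mem_center_iff.1 (hNc ha) b
  set w := x * y with hw
  set H := Subgroup.zpowers w ⊔ N
  have hNn := hN.normal
  obtain ⟨C, e, he, hC⟩ := exists_isIso_zpowers_central (h w)
  obtain ⟨R, f, hf, hfe⟩ :=
    exists_isIso_sup hS hF hN (fun a ha b _ => (hcen ha b).symm) _ C e he
  have hR : R ≤ Subgroup.center S := by
    intro r hr
    obtain ⟨⟨u, hu⟩, hur⟩ := f.surjective ⟨r, hr⟩
    obtain ⟨a, ha, b, hb, rfl⟩ := Subgroup.mem_sup_of_normal_right.1 hu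
    have h1 : f ⟨a * b, hu⟩ =
        f ⟨a, Subgroup.mem_sup_left ha⟩ * f ⟨b, Subgroup.mem_sup_right hb⟩ := by
      rw [← map_mul]; rfl
    obtain rfl := Subtype.ext_iff.1 (h1.symm.trans hur)
    refine mul_mem ?_ (hNc ((hN.mem_iff hf _).2 hb))
    refine (hfe ⟨a, ha⟩).symm ▸ ?_
    exact hC (e ⟨a, ha⟩).2
  obtain ⟨D, u, hu, hDa, hD⟩ := exists_central_of_le_center hF hR
  have hxw : x * w * x⁻¹ = w⁻¹ * (x ^ 2 * y ^ 2) := by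
    have h1 : x * w * x⁻¹ = x ^ 2 * (y * x⁻¹) := by rw [hw, sq]; simp only [mul_assoc]
    have h2 : w⁻¹ * (x ^ 2 * y ^ 2) = (y⁻¹ * x⁻¹) * (x ^ 2 * y ^ 2) := by rw [hw]; group
    have h3 : (y⁻¹ * x⁻¹) * (x ^ 2 * y ^ 2) = x ^ 2 * ((y⁻¹ * x⁻¹) * y ^ 2) := by
      rw [← mul_assoc, hcen hx, mul_assoc]
    have h4 : (y⁻¹ * x⁻¹) * y ^ 2 = y * x⁻¹ := by
      rw [hcen hy]; group
    rw [h1, h2, h3, h4]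
  have hconj : ∀ a ∈ H, x * a * x⁻¹ ∈ H := by
    have : H ≤ H.comap (MulAut.conj x).toMonoidHom := by
      refine sup_le ?_ ?_
      · rw [Subgroup.zpowers_le]
        change x * w * x⁻¹ ∈ H
        rw [hxw]
        exact mul_mem (inv_mem (Subgroup.mem_sup_left (Subgroup.mem_zpowers w)))
          (Subgroup.mem_sup_right (mul_mem hx hy))
      · exact fun a ha => Subgroup.mem_sup_right (hNn.conj_mem a ha x)
    exact this
  have hsq (a : S) : x * (x * a * x⁻¹) * x⁻¹ = a := by
    have : x * (x * a * x⁻¹) * x⁻¹ = x ^ 2 * a * (x ^ 2)⁻¹ := by simp only [sq, mul_inv_rev, mul_assoc]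
    rw [this, ← hcen hx, mul_inv_cancel_right]
  have hxn : x ∈ Subgroup.normalizer (H : Set S) := by
    rw [Subgroup.mem_normalizer_iff]
    exact fun a => ⟨hconj a, fun ha => by simpa only [hsq] using hconj _ ha⟩
  -- Conjugation by `x` squares to 1 because `x ^ 2` is central; transported to `D` it must be
  -- trivial.
  have hα : MulAut.congr (f.trans u) (H.normalizerMonoidHom ⟨x, hxn⟩) = 1 := by
    refine aut_eq_one_of_sq_eq_one hDa hD (conj_mem_aut (hf.trans hu) ⟨x, hxn⟩) ?_
    have h1 : H.normalizerMonoidHom ⟨x, hxn⟩ ^ 2 = 1 := by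
      ext a
      rw [sq]
      exact hsq a
    rw [← map_pow, h1, map_one]
  have hw1 : H.normalizerMonoidHom ⟨x, hxn⟩ = 1 :=
    (map_eq_one_iff (MulAut.congr (f.trans u)) (MulEquiv.injective _)).1 hα
  have hw2 : x * w * x⁻¹ = w := Subtype.ext_iff.1
    (DFunLike.congr_fun hw1 (⟨w, Subgroup.mem_sup_left (Subgroup.mem_zpowers w)⟩ : H))
  rw [hw] at hw2 ⊢
  rw [mul_inv_eq_iff_eq_mul, mul_assoc x y x] at hw2
  exact mul_left_cancel hw2

/-- If every element of `S` is `F`-conjugate to a central one, then abelian strongly closed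
subgroups are central. -/
theorem StronglyClosed.le_center [Finite S] {p : ℕ} [Fact p.Prime] (hS : IsPGroup p S)
    (hF : F.IsSaturated p)
    (h : ∀ x : S, (F.Hom (Subgroup.zpowers x) (Subgroup.center S)).Nonempty)
    {E : Subgroup S} (hE : F.StronglyClosed E) (hcomm : ∀ a ∈ E, ∀ b ∈ E, a * b = b * a) :
    E ≤ Subgroup.center S := by
  intro b hb
  rw [Subgroup.mem_center_iff]
  intro s
  obtain ⟨C, e, he, hC⟩ := exists_isIso_zpowers_central (h s)
  obtain ⟨R, f, hf, hfe⟩ := exists_isIso_sup hS hF hE hcomm _ C e he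
  let s' : (Subgroup.zpowers s ⊔ E : Subgroup S) :=
    ⟨s, Subgroup.mem_sup_left (Subgroup.mem_zpowers s)⟩
  let b' : (Subgroup.zpowers s ⊔ E : Subgroup S) := ⟨b, Subgroup.mem_sup_right hb⟩
  -- Since `f` is injective, it suffices that the image of `s` commutes with that of `b`.
  have hs : (f s' : S) ∈ Subgroup.center S := by
    refine (hfe ⟨s, Subgroup.mem_zpowers s⟩).symm ▸ ?_
    exact hC (e _).2
  have h1 : f (s' * b') = f (b' * s') := by
    rw [map_mul, map_mul]
    exact Subtype.ext (Subgroup.mem_center_iff.1 hs _).symm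
  exact congrArg Subtype.val (f.injective h1)

theorem mem_center_of_pow_eq_one [Finite S] (hS : IsPGroup 2 S) (hF : F.IsSaturated 2)
    (h : ∀ x : S, (F.Hom (Subgroup.zpowers x) (Subgroup.center S)).Nonempty) (k : ℕ) :
    ∀ x : S, x ^ 2 ^ k = 1 → x ∈ Subgroup.center S := by
  have : Fact (Nat.Prime 2) := ⟨Nat.prime_two⟩
  induction k with
  | zero => intro x hx; simp_all [one_mem]
  | succ k ih =>
    let N : Subgroup S :=
      { carrier := {x | x ^ 2 ^ k = 1}
        one_mem' := one_pow _
        mul_mem' := fun {a b} (ha : a ^ 2 ^ k = 1) (hb : b ^ 2 ^ k = 1) => by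
          have hc : Commute a b := Subgroup.mem_center_iff.1 (ih b hb) a
          rw [Set.mem_ofPred_eq, hc.mul_pow, ha, hb, one_mul]
        inv_mem' := fun {a} (ha : a ^ 2 ^ k = 1) => by simp [ha] }
    have hsq (a : S) (ha : a ^ 2 ^ (k + 1) = 1) : a ^ 2 ∈ N := by
      change (a ^ 2) ^ 2 ^ k = 1
      rwa [← pow_mul, ← pow_succ']
    have hcomm (a b : S) (ha : a ^ 2 ^ (k + 1) = 1) (hb : b ^ 2 ^ (k + 1) = 1) :
        a * b = b * a :=
      commute_of_sq_mem hS hF h (stronglyClosed_of_forall_mem_iff_pow fun _ => Iff.rfl) ih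
        (hsq a ha) (hsq b hb)
    let E : Subgroup S :=
      { carrier := {x | x ^ 2 ^ (k + 1) = 1}
        one_mem' := one_pow _
        mul_mem' := fun {a b} (ha : a ^ 2 ^ (k + 1) = 1) (hb : b ^ 2 ^ (k + 1) = 1) => by
          have hc : Commute a b := hcomm a b ha hb
          rw [Set.mem_ofPred_eq, hc.mul_pow, ha, hb, one_mul]
        inv_mem' := fun {a} (ha : a ^ 2 ^ (k + 1) = 1) => by simp [ha] }
    have hE : F.StronglyClosed E := stronglyClosed_of_forall_mem_iff_pow fun _ => Iff.rfl
    exact fun x hx => hE.le_center hS hF h (fun a ha b hb => hcomm a b ha hb) hx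

end FusionSystem

theorem theorem1 {S : Type*} [Group S] [Finite S] (hS : IsPGroup 2 S)
    (F : FusionSystem S) (hF : F.IsSaturated 2)
    (h : ∀ x : S, (F.Hom (Subgroup.zpowers x) (Subgroup.center S)).Nonempty) :
    ∀ a b : S, a * b = b * a := by
  intro a b
  obtain ⟨k, hk⟩ := hS b
  exact Subgroup.mem_center_iff.1 (F.mem_center_of_pow_eq_one hS hF h k b hk) a
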